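/- **Colored graphs.** A colored graph $G$ is a finite simple graph together with a function $c$ that assigns a color to each vertex and to each edge; $A_{G_d}$ denotes the adjacency matrix of the edges of color $d$. An isomorphism of colored graphs is a graph isomorphism that preserves the vertex colors and the edge colors. **Quantum symmetry.** $C(\mathrm{Qut}(G))$ is the universal unital $C^*$-algebra with generators $u_{ij}$, $i,j\in V(G)$, and relations $u_{ij}=u_{ij}^*=u_{ij}^2$; $\sum_l u_{il}=1=\sum_l u_{li}$ for all $i$; $u_{ij}=0$ if $c(i)\ne c(j)$; and $A_{G_d}u=uA_{G_d}$ for every edge color $d$. The graph $G$ has quantum symmetry if $C(\mathrm{Qut}(G))$ is not commutative. **Quantum isomorphism.** In the $(G,G')$-isomorphism game, Alice and Bob each receive and return an element of the disjoint union $V(G)\sqcup V(G')$. To win, each player must answer a vertex of one graph with a vertex of the other. Let $g_a\in V(G)$, $g_a'\in V(G')$ be the two vertices formed by Alice's input and output, and $g_b,g_b'$ likewise those of Bob. They win if moreover (1) $c(g_a)=c'(g_a')$ and $c(g_b)=c'(g_b')$; (2) $g_a=g_b$ if and only if $g_a'=g_b'$; (3) for every color $d$, $(g_a,g_b)$ is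 an edge of color $d$ if and only if $(g_a',g_b')$ is. The graphs $G$ and $G'$ are quantum isomorphic if some quantum strategy in the commuting operator framework (a unit vector $\psi$ in a Hilbert space and, for each input $x$, POVMs $(E_{xy})_y$ of Alice and $(F_{xy})_y$ of Bob, with every $E_{xy}$ commuting with every $F_{x'y'}$; the probability of the answers $y,y'$ to the inputs $x,x'$ is $\langle\psi,E_{xy}F_{x'y'}\psi\rangle$) wins this game with probability $1$ on every pair of inputs. **The graphs.** Let $H$ be a connected simple graph, let $M\in\mathbb F_2^{V(H)\times E(H)}$ be its incidence matrix ($M_{ki}=1$ if and only if the vertex $k$ is incident to the edge $i$), let $b\in\mathbb F_2^{V(H)}$, and put $S_k=\{i: M_{ki}=1\}$. The vertices of the colored graph $G_*(M,b)$ are the pairs $(k,\alpha)$ with $k\in V(H)$ and $\alpha:S_k\to\{1,-1\}$ such that $\prod_{i\in S_k}\alpha_i=(-1)^{b_k}$; the color of $(k,\alpha)$ is $k$. Distinct vertices $(k,\alpha)$ and $(k,\beta)$ are joined by an edge whose color is the function $i\mapsto\alpha_i\beta_i$ on $S_k$. For $k\neq l$, the vertices $(k,\alpha)$ and $(l,\beta)$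 are joined by an edge, of color $-1$, if $S_k\cap S_l=\{i\}$ for some $i$ and $\alpha_i\beta_i=-1$; there are no other edges. **Corollary.** Let $M$ be the incidence matrix of $K_{3,3}$ and let $b\in\mathbb F_2^{V(K_{3,3})}$ be any vector with exactly one entry equal to $1$. Then the colored graphs $G_*(M,0)$ and $G_*(M,b)$ are not isomorphic and neither of them has quantum symmetry, but they are quantum isomorphic. -/

import Mathlib

open scoped ENNReal

noncomputable section

/-! ### Colored graphs -/

/-- A vertex- and edge-colored graph: a simple graph with a color in `C` for each vertex and a
color in `D` for each edge. -/
structure ColoredGraph (V C D : Type) where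
  graph : SimpleGraph V
  vertexColor : V → C
  edgeColor : graph.EdgeLabeling D

namespace ColoredGraph

variable {V V' C D : Type}

/-- The graph formed by the edges of color `d`. -/
def edgesOfColor (G : ColoredGraph V C D) (d : D) : SimpleGraph V :=
  G.edgeColor.labelGraph d

open Classical in
/-- The adjacency matrix of the edge color `d`, with entries in `A`. -/
def colorAdjMatrix (G : ColoredGraph V C D) (A : Type*) [Zero A] [One A] (d : D) : Matrix V V A :=
  (G.edgesOfColor d).adjMatrix A

/-- Isomorphism of colored graphs: a bijection of the vertices that preserves the vertex colors,
adjacency, and the edge colors. -/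
def Isomorphic (G : ColoredGraph V C D) (G' : ColoredGraph V' C D) : Prop :=
  ∃ f : G.graph ≃g G'.graph, (∀ v, G'.vertexColor (f v) = G.vertexColor v) ∧
    ∀ (v w : V) (h : G.graph.Adj v w),
      G'.edgeColor.get (f v) (f w) (f.map_adj_iff.2 h) = G.edgeColor.get v w h

/-! ### The quantum automorphism group -/

/-- The relations on a matrix `u` over a C*-algebra, indexed by the vertices of two colored graphs:
all entries are projections, rows and columns sum to `1`, entries between vertices of different
colors vanish, and `u` intertwines the adjacency matrices of each edge color. -/
structure Intertwines [Fintype V] [Fintype V'] {A : Type*} [CStarAlgebra A]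
    (G : ColoredGraph V C D) (G' : ColoredGraph V' C D) (u : Matrix V V' A) : Prop where
  isStarProjection : ∀ i j, IsStarProjection (u i j)
  row_sum : ∀ i, ∑ j, u i j = 1
  col_sum : ∀ j, ∑ i, u i j = 1
  color : ∀ i j, G.vertexColor i ≠ G'.vertexColor j → u i j = 0
  adj : ∀ d : D, G.colorAdjMatrix A d * u = u * G'.colorAdjMatrix A d

/-- A realization, in a nonzero C*-algebra, of the relations that define `C(Qut(G))`. (A C*-algebra
generated by finitely many elements has at most continuum many elements, so algebras in `Type`
suffice; see `Qut.existsUnique_hom`.) -/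
structure QutRep [Fintype V] (G : ColoredGraph V C D) where
  carrier : Type
  [cstar : CStarAlgebra carrier]
  [nontrivial : Nontrivial carrier]
  u : Matrix V V carrier
  rel : G.Intertwines G u

attribute [instance] QutRep.cstar QutRep.nontrivial

variable [Fintype V]

/-- The C*-algebra of all bounded families indexed by the realizations of the relations. -/
abbrev QutRep.Prod (G : ColoredGraph V C D) : Type 1 :=
  lp (fun ρ : QutRep G => ρ.carrier) ∞

instance (G : ColoredGraph V C D) : CStarAlgebra (QutRep.Prod G) where

/-- The family of all `(i, j)` entries. -/
def QutRep.gen (G : ColoredGraph V C D) (i j : V) : QutRep.Prod G :=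
  ⟨fun ρ => ρ.u i j, memℓp_infty ⟨1, by
    rintro _ ⟨ρ, rfl⟩
    exact (ρ.rel.isStarProjection i j).norm_le⟩⟩

/-- `C(Qut(G))`, the universal C*-algebra with generators `u i j` (for vertices `i`, `j`) subject to
the relations `Intertwines G G u`: the C*-algebra generated by the entries of the direct sum of all
realizations of the relations. Its universal property is `Qut.existsUnique_hom`. -/
def qutAlgebra (G : ColoredGraph V C D) : StarSubalgebra ℂ (QutRep.Prod G) :=
  (StarAlgebra.adjoin ℂ (Set.range fun p : V × V => QutRep.gen G p.1 p.2)).topologicalClosure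

abbrev Qut (G : ColoredGraph V C D) : Type 1 := G.qutAlgebra

instance (G : ColoredGraph V C D) : CStarAlgebra G.Qut :=
  haveI : IsClosed (G.qutAlgebra : Set (QutRep.Prod G)) :=
    StarSubalgebra.isClosed_topologicalClosure _
  StarSubalgebra.cstarAlgebra G.qutAlgebra

/-- The fundamental representation `u` of `Qut(G)`. -/
def Qut.u (G : ColoredGraph V C D) : Matrix V V G.Qut := fun i j =>
  ⟨QutRep.gen G i j, StarSubalgebra.le_topologicalClosure _
    (StarAlgebra.subset_adjoin ℂ _ ⟨(i, j), rfl⟩)⟩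

/-- Evaluation of bounded families at a realization. -/
def QutRep.eval {G : ColoredGraph V C D} (ρ : QutRep G) : QutRep.Prod G →⋆ₐ[ℂ] ρ.carrier where
  toFun a := a ρ
  map_one' := congrFun lp.infty_coeFn_one ρ
  map_mul' a b := congrFun (lp.infty_coeFn_mul a b) ρ
  map_zero' := rfl
  map_add' _ _ := rfl
  commutes' _ := rfl
  map_star' _ := rfl

/-- Evaluation of elements of `C(Qut(G))` at a realization. -/
def Qut.eval {G : ColoredGraph V C D} (ρ : QutRep G) : G.Qut →⋆ₐ[ℂ] ρ.carrier :=
  ρ.eval.comp G.qutAlgebra.subtype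

theorem Qut.eval_u {G : ColoredGraph V C D} (ρ : QutRep G) (i j : V) :
    Qut.eval ρ (Qut.u G i j) = ρ.u i j := rfl

theorem Qut.ext_eval {G : ColoredGraph V C D} {a b : G.Qut}
    (h : ∀ ρ : QutRep G, Qut.eval ρ a = Qut.eval ρ b) : a = b :=
  Subtype.ext (lp.ext (funext h))

theorem Intertwines.map {V' : Type} [Fintype V'] {G : ColoredGraph V C D}
    {G' : ColoredGraph V' C D} {A B F : Type*}
    [CStarAlgebra A] [CStarAlgebra B] [FunLike F A B] [RingHomClass F A B] [StarHomClass F A B]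
    (φ : F) {u : Matrix V V' A} (h : G.Intertwines G' u) :
    G.Intertwines G' (u.map φ) where
  isStarProjection i j := (h.isStarProjection i j).map φ
  row_sum i := by simp [← map_sum, h.row_sum]
  col_sum j := by simp [← map_sum, h.col_sum]
  color i j hij := by simp [h.color i j hij]
  adj d := by
    have hG : ∀ {W : Type} (K : ColoredGraph W C D),
        K.colorAdjMatrix B d = (K.colorAdjMatrix A d).map φ := by
      intro W K
      ext a b
      simp only [colorAdjMatrix, SimpleGraph.adjMatrix_apply, Matrix.map_apply]
      split_ifs <;> simp
    ext a b
    have := congrArg φ (congrFun (congrFun (h.adj d) a) b)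
    simpa [hG, Matrix.mul_apply] using this

theorem Intertwines.of_map {V' : Type} [Fintype V'] {G : ColoredGraph V C D}
    {G' : ColoredGraph V' C D} {A B F : Type*}
    [CStarAlgebra A] [CStarAlgebra B] [FunLike F A B] [RingHomClass F A B] [StarHomClass F A B]
    (φ : F) (hφ : Function.Injective φ) {u : Matrix V V' A} (h : G.Intertwines G' (u.map φ)) :
    G.Intertwines G' u where
  isStarProjection i j :=
    ⟨hφ (by rw [map_mul]; exact (h.isStarProjection i j).1),
      hφ (by rw [map_star]; exact (h.isStarProjection i j).2)⟩
  row_sum i := hφ (by simpa using h.row_sum i)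
  col_sum j := hφ (by simpa using h.col_sum j)
  color i j hij := hφ (by simpa using h.color i j hij)
  adj d := Matrix.ext fun a b => hφ (by
    have := congrFun (congrFun (h.adj d) a) b
    simp only [Matrix.mul_apply, map_sum, map_mul, Matrix.map_apply, colorAdjMatrix,
      SimpleGraph.adjMatrix_apply, apply_ite φ, map_one, map_zero] at this ⊢
    exact this)

/-- The fundamental representation satisfies the defining relations. -/
theorem Qut.intertwines_u (G : ColoredGraph V C D) : G.Intertwines G (Qut.u G) where
  isStarProjection i j :=
    ⟨Qut.ext_eval fun ρ => by
        rw [map_mul, Qut.eval_u]; exact (ρ.rel.isStarProjection i j).1,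
      Qut.ext_eval fun ρ => by
        rw [map_star, Qut.eval_u]; exact (ρ.rel.isStarProjection i j).2⟩
  row_sum i := Qut.ext_eval fun ρ => by simp [Qut.eval_u, ρ.rel.row_sum]
  col_sum j := Qut.ext_eval fun ρ => by simp [Qut.eval_u, ρ.rel.col_sum]
  color i j h := Qut.ext_eval fun ρ => by simp [Qut.eval_u, ρ.rel.color i j h]
  adj d := by
    refine Matrix.ext fun i j => Qut.ext_eval fun ρ => ?_
    have := congrFun (congrFun (ρ.rel.adj d) i) j
    simp only [Matrix.mul_apply, map_sum, map_mul, Qut.eval_u, colorAdjMatrix,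
      SimpleGraph.adjMatrix_apply, apply_ite (Qut.eval ρ), map_one, map_zero] at this ⊢
    exact this

open scoped CStarAlgebra in
theorem Qut.hom_ext {G : ColoredGraph V C D} {B : Type*} [CStarAlgebra B]
    {φ ψ : G.Qut →⋆ₐ[ℂ] B} (h : ∀ i j, φ (Qut.u G i j) = ψ (Qut.u G i j)) : φ = ψ := by
  have hφ : Continuous φ := map_continuous φ
  have hψ : Continuous ψ := map_continuous ψ
  refine StarAlgHom.ext_topologicalClosure hφ hψ (StarAlgHom.ext_adjoin ?_)
  rintro ⟨_, _⟩ ⟨⟨i, j⟩, rfl⟩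
  exact h i j

/-- A C*-algebra whose carrier is small is isomorphic to one in `Type`. -/
theorem exists_small_cstarAlgebra (S : Type*) [CStarAlgebra S] [Small.{0} S] :
    ∃ (T : Type) (_ : CStarAlgebra T), Nonempty (T ≃⋆ₐ[ℂ] S) := by
  let e : Shrink.{0} S ≃ₐ[ℂ] S := Shrink.algEquiv ℂ S
  let : NormedRing (Shrink.{0} S) := NormedRing.induced _ _ e e.injective
  let : NormedAlgebra ℂ (Shrink.{0} S) := NormedAlgebra.induced ℂ _ _ e
  have hn : ∀ x : Shrink.{0} S, ‖x‖ = ‖e x‖ := fun _ => rfl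
  have hiso : Isometry e := AddMonoidHomClass.isometry_of_norm e fun _ => rfl
  let : StarRing (Shrink.{0} S) :=
    { star := fun x => e.symm (star (e x))
      star_involutive := fun x => by simp
      star_mul := fun x y => by simp
      star_add := fun x y => by simp }
  have hs : ∀ x : Shrink.{0} S, e (star x) = star (e x) := fun x => e.apply_symm_apply _
  have : CStarRing (Shrink.{0} S) :=
    ⟨fun x => by rw [hn, hn, map_mul, hs]; exact CStarRing.norm_mul_self_le _⟩
  have : CompleteSpace (Shrink.{0} S) :=
    (hiso.isUniformInducing.completeSpace_congr e.surjective).2 inferInstance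
  have : StarModule ℂ (Shrink.{0} S) :=
    ⟨fun r x => e.injective (by rw [hs, map_smul, star_smul, map_smul, hs])⟩
  exact ⟨Shrink.{0} S, { }, ⟨StarAlgEquiv.ofAlgEquiv e hs⟩⟩

/-- Universal property of `C(Qut(G))`, for C*-algebras in an arbitrary universe. -/
theorem Qut.existsUnique_hom (G : ColoredGraph V C D) {B : Type*} [CStarAlgebra B]
    (v : Matrix V V B) (hv : G.Intertwines G v) :
    ∃! φ : G.Qut →⋆ₐ[ℂ] B, ∀ i j, φ (Qut.u G i j) = v i j := by
  suffices h : ∃ φ : G.Qut →⋆ₐ[ℂ] B, ∀ i j, φ (Qut.u G i j) = v i j by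
    obtain ⟨φ, hφ⟩ := h
    exact ⟨φ, hφ, fun ψ hψ => Qut.hom_ext fun i j => (hψ i j).trans (hφ i j).symm⟩
  rcases subsingleton_or_nontrivial B with hB | hB
  · exact ⟨
      { toFun := fun _ => 0
        map_one' := Subsingleton.elim _ _
        map_mul' := fun _ _ => Subsingleton.elim _ _
        map_zero' := rfl
        map_add' := fun _ _ => Subsingleton.elim _ _
        commutes' := fun _ => Subsingleton.elim _ _
        map_star' := fun _ => Subsingleton.elim _ _ }, fun _ _ => Subsingleton.elim _ _⟩
  let s : Set B := Set.range fun p : V × V => v p.1 p.2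
  let S : StarSubalgebra ℂ B := (StarAlgebra.adjoin ℂ s).topologicalClosure
  have hvS : ∀ i j, v i j ∈ S := fun i j => StarSubalgebra.le_topologicalClosure _
    (StarAlgebra.subset_adjoin ℂ _ ⟨(i, j), rfl⟩)
  have hS : IsClosed (S : Set B) := StarSubalgebra.isClosed_topologicalClosure _
  have : Small.{0} S := by
    have h1 : Small.{0} (StarAlgebra.adjoin ℂ s : Set B) := by
      have hsub : (StarAlgebra.adjoin ℂ s : Set B) ⊆
          Set.range (FreeAlgebra.lift ℂ (fun p : V × V => v p.1 p.2)) := by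
        intro x hx
        have hstar : star s = s := by
          ext y
          constructor
          · rintro ⟨p, hp⟩
            refine ⟨p, ?_⟩
            rw [← star_star y, ← hp]
            exact (hv.isStarProjection p.1 p.2).2.symm
          · rintro ⟨p, rfl⟩
            exact ⟨p, (hv.isStarProjection p.1 p.2).2.symm⟩
        have hx' : x ∈ (StarAlgebra.adjoin ℂ s).toSubalgebra := hx
        rw [StarAlgebra.adjoin_toSubalgebra, hstar, Set.union_self,
          Algebra.adjoin_range_eq_range_freeAlgebra_lift] at hx'
        exact hx'
      exact small_subset hsub
    have hsurj : ∀ x : S, ∃ f : ℕ → (StarAlgebra.adjoin ℂ s : Set B),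
        Filter.Tendsto (fun n => (f n : B)) Filter.atTop (nhds (x : B)) := by
      rintro ⟨x, hx⟩
      obtain ⟨f, hf, hfx⟩ := mem_closure_iff_seq_limit.1 hx
      exact ⟨fun n => ⟨f n, hf n⟩, hfx⟩
    choose F hF using hsurj
    refine small_of_injective (f := F) fun x y hxy => Subtype.ext ?_
    exact tendsto_nhds_unique (hF x) (by rw [hxy]; exact hF y)
  obtain ⟨T, _, ⟨e⟩⟩ := exists_small_cstarAlgebra S
  have : Nontrivial T := e.toEquiv.nontrivial
  let vS : Matrix V V S := fun i j => ⟨v i j, hvS i j⟩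
  have hvS' : G.Intertwines G vS := .of_map S.subtype Subtype.coe_injective hv
  let ρ : QutRep G := { carrier := T, u := vS.map e.symm, rel := hvS'.map e.symm }
  exact ⟨(S.subtype.comp (e : T →⋆ₐ[ℂ] S)).comp (Qut.eval ρ), fun i j => by
    change ((e (e.symm (vS i j)) : S) : B) = v i j
    rw [StarAlgEquiv.apply_symm_apply]⟩

/-- `G` has quantum symmetry if the C*-algebra `C(Qut(G))` is not commutative. -/
def HasQuantumSymmetry (G : ColoredGraph V C D) : Prop :=
  ¬ ∀ a b : G.Qut, a * b = b * a

/-! ### The isomorphism game and quantum isomorphism -/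

/-- One player's input `x` and output `y` in the isomorphism game: one of them is the vertex `g` of
the first graph and the other is the vertex `g'` of the second graph. -/
def IsPlay {V V' : Type} (x y : V ⊕ V') (g : V) (g' : V') : Prop :=
  (x = .inl g ∧ y = .inr g') ∨ (x = .inr g' ∧ y = .inl g)

/-- The winning condition of the `(G, G')`-isomorphism game, when Alice answers `y` to the input `x`
and Bob answers `y'` to the input `x'`. -/
def Wins {V V' C D : Type} (G : ColoredGraph V C D) (G' : ColoredGraph V' C D)
    (x x' y y' : V ⊕ V') : Prop :=
  ∃ (ga gb : V) (ga' gb' : V'), IsPlay x y ga ga' ∧ IsPlay x' y' gb gb' ∧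
    (G.vertexColor ga = G'.vertexColor ga' ∧ G.vertexColor gb = G'.vertexColor gb') ∧
    (ga = gb ↔ ga' = gb') ∧
    ∀ d : D, (G.edgesOfColor d).Adj ga gb ↔ (G'.edgesOfColor d).Adj ga' gb'

end ColoredGraph

/-- A quantum strategy in the commuting operator framework, for a two-player game with inputs and
outputs in `Q` for both players: a unit vector `ψ` of a Hilbert space `H` and, for each input, a
POVM for Alice and one for Bob, such that the operators of Alice commute with those of Bob. -/
structure CommutingStrategy (Q H : Type) [Fintype Q] [NormedAddCommGroup H]
    [InnerProductSpace ℂ H] [CompleteSpace H] where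
  ψ : H
  norm_ψ : ‖ψ‖ = 1
  alice : Q → Q → H →L[ℂ] H
  alice_pos : ∀ x y, (alice x y).IsPositive
  alice_sum : ∀ x, ∑ y, alice x y = 1
  bob : Q → Q → H →L[ℂ] H
  bob_pos : ∀ x y, (bob x y).IsPositive
  bob_sum : ∀ x, ∑ y, bob x y = 1
  commute : ∀ x y x' y', Commute (alice x y) (bob x' y')

/-- The probability that Alice and Bob answer `y` and `y'` to the inputs `x` and `x'`. -/
def CommutingStrategy.prob {Q H : Type} [Fintype Q] [NormedAddCommGroup H]
    [InnerProductSpace ℂ H] [CompleteSpace H] (S : CommutingStrategy Q H) (x x' y y' : Q) : ℝ :=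
  (inner ℂ S.ψ (S.alice x y (S.bob x' y' S.ψ))).re

namespace ColoredGraph

open Classical in
/-- `G` and `G'` are quantum isomorphic: some quantum strategy wins the `(G, G')`-isomorphism game
with probability `1` on every pair of inputs. (Separable Hilbert spaces suffice, so Hilbert spaces
in `Type` are no restriction.) -/
def QuantumIsomorphic {V V' C D : Type} [Fintype V] [Fintype V']
    (G : ColoredGraph V C D) (G' : ColoredGraph V' C D) : Prop :=
  ∃ (H : Type) (_ : NormedAddCommGroup H) (_ : InnerProductSpace ℂ H) (_ : CompleteSpace H)
    (S : CommutingStrategy (V ⊕ V') H), ∀ x x' : V ⊕ V',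
      ∑ y, ∑ y', (if Wins G G' x x' y y' then S.prob x x' y y' else 0) = 1

end ColoredGraph

end

/-! ### The colored graphs of a linear system over the field with two elements -/

/-- The incidence matrix of a graph, with rows indexed by the vertices and columns by the edges. -/
def edgeIncidenceMatrix {W : Type} [DecidableEq W] (H : SimpleGraph W) :
    Matrix W H.edgeSet (ZMod 2) :=
  Matrix.of fun k e => if k ∈ (e : Sym2 W) then 1 else 0

/-- `S_k(M)`, the set of the variables that occur in the `k`-th equation. -/
abbrev EqnSupport {m n : Type} (M : Matrix m n (ZMod 2)) (k : m) : Type :=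
  {i : n // M k i = 1}

/-- The assignments `α` of signs to the variables that occur in the `k`-th equation which satisfy
that equation: the product of the signs is `(-1) ^ b k`. -/
abbrev SatAssignment {m n : Type} [Fintype n] (M : Matrix m n (ZMod 2)) (b : m → ZMod 2)
    (k : m) : Type :=
  {α : EqnSupport M k → ℤˣ // ∏ i, α i = (-1) ^ (b k).val}

/-- Pairs `(k, α)` of an equation `k` and a satisfying assignment `α` of it. -/
abbrev SolVertex {m n : Type} [Fintype n] (M : Matrix m n (ZMod 2)) (b : m → ZMod 2) : Type :=
  Σ k : m, SatAssignment M b k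

instance {m n : Type} [Fintype n] [DecidableEq n] (M : Matrix m n (ZMod 2)) (b : m → ZMod 2)
    (k : m) : Fintype (SatAssignment M b k) :=
  inferInstance

instance {m n : Type} [Fintype m] [Fintype n] [DecidableEq n] (M : Matrix m n (ZMod 2))
    (b : m → ZMod 2) : Fintype (SolVertex M b) :=
  Sigma.instFintype (κ := fun k => SatAssignment M b k)

namespace SolVertex

variable {m n : Type} [Fintype n] {M : Matrix m n (ZMod 2)} {b : m → ZMod 2}

/-- The equations of `x` and `y` share a variable, to which `x` and `y` give opposite signs. -/
def Disagree (x y : SolVertex M b) : Prop :=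
  ∃ (i : n) (hx : M x.1 i = 1) (hy : M y.1 i = 1), x.2.1 ⟨i, hx⟩ * y.2.1 ⟨i, hy⟩ = -1

/-- Distinct vertices are adjacent if they belong to the same equation or disagree on a variable
shared by their equations. -/
def adjGraph (M : Matrix m n (ZMod 2)) (b : m → ZMod 2) : SimpleGraph (SolVertex M b) where
  Adj x y := x ≠ y ∧ (x.1 = y.1 ∨ Disagree x y)
  symm := ⟨fun x y ⟨hne, h⟩ => ⟨hne.symm, h.imp Eq.symm
    fun ⟨i, hx, hy, hi⟩ => ⟨i, hy, hx, by rw [mul_comm]; exact hi⟩⟩⟩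
  loopless := ⟨fun _ h => h.1 rfl⟩

/-- The color of an edge: for an edge between `(k, α)` and `(k, β)`, the function `α △ β` given by
`i ↦ α i * β i` on the variables of equation `k`; for an edge between different equations, `-1`. -/
def edgeColorFun [DecidableEq m] (x y : SolVertex M b) :
    (Σ k : m, EqnSupport M k → ℤˣ) ⊕ ℤˣ :=
  if h : x.1 = y.1 then .inl ⟨x.1, fun i => x.2.1 i * y.2.1 ⟨i.1, h ▸ i.2⟩⟩ else .inr (-1)

theorem edgeColorFun_comm [DecidableEq m] (x y : SolVertex M b) :
    edgeColorFun y x = edgeColorFun x y := by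
  obtain ⟨k, α⟩ := x
  obtain ⟨l, β⟩ := y
  by_cases h : k = l
  · subst h
    simp [edgeColorFun, mul_comm]
  · simp [edgeColorFun, h, Ne.symm h]

end SolVertex

/-- The colored graph `G_*(M, b)` of the linear system `M x = b`, where any two distinct rows of `M`
have at most one common nonzero entry (such as the incidence matrix of a graph). Its vertices are
the pairs `(k, α)` of an equation and a satisfying assignment, and `(k, α)` has color `k`. Distinct
vertices `(k, α)` and `(k, β)` are joined by an edge of color `α △ β`. For `k ≠ l`, vertices
`(k, α)` and `(l, β)` are joined by an edge, of color `-1`, if there is a variable `i` common to both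
equations and `α i * β i = -1`; there is no edge if `α i * β i = 1`. -/
def GStar {m n : Type} [Fintype n] [DecidableEq m] (M : Matrix m n (ZMod 2)) (b : m → ZMod 2) :
    ColoredGraph (SolVertex M b) m ((Σ k : m, EqnSupport M k → ℤˣ) ⊕ ℤˣ) where
  graph := SolVertex.adjGraph M b
  vertexColor x := x.1
  edgeColor := SimpleGraph.EdgeLabeling.mk (fun x y _ => SolVertex.edgeColorFun x y)
    fun x y _ => SolVertex.edgeColorFun_comm x y

/-- The complete bipartite graph `K_{3,3}`. -/
abbrev K33 : SimpleGraph (Fin 3 ⊕ Fin 3) := completeBipartiteGraph (Fin 3) (Fin 3)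

instance : DecidableRel K33.Adj := fun v w =>
  inferInstanceAs (Decidable (v.isLeft ∧ w.isRight ∨ v.isRight ∧ w.isLeft))

/-! The proof passes between matrices `u` indexed by the vertices of the graphs for `b` and `b'` and
operator solutions of the linear system with the signs `(-1) ^ b k * (-1) ^ b' k`. Such a solution
has one operator of square `1` for each edge of `K_{3,3}`; the three at a vertex commute and
multiply to the sign of that vertex. The edges form a `3 × 3` grid whose rows and columns are the
left and right vertices, so a solution is an `IsOperatorSquare`.

From `u` to a square: fix a vertex `v` of equation `k` and weight the projections `u v w` by the
products of the signs of `v` and `w`. This gives three operators that solve equation `k`. The edges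
of color `-1` between different equations force the operators from rows at left equations to equal
those from columns at right equations, so each depends only on an edge of `K_{3,3}`
(`Intertwines.exists_isOperatorSquare`). Conversely, `u v w` is the joint spectral projection for
the products of signs, and a self-adjoint square of complex matrices gives a perfect strategy
(`quantumIsomorphic_of_isOperatorSquare`).

Three facts about squares then suffice. If `b = b'`, all signs are `1` and the operators commute
(`IsOperatorSquare.commute`), hence so do the entries of `u`: there is no quantum symmetry. An
isomorphism gives a square of scalars, whose product can be computed by rows or by columns, so the
total sign is `1`; here it is `-1`. With total sign `-1`, a signed Mermin–Peres magic square solves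
the system in `4 × 4` matrices. -/

/-! ### The signs of a vertex of the colored graph of `K_{3,3}` -/

namespace K33

/-- The edge of `K_{3,3}` that joins the `i`-th left vertex and the `j`-th right vertex. -/
def edge (i j : Fin 3) : K33.edgeSet :=
  ⟨s(.inl i, .inr j), by simp [SimpleGraph.mem_edgeSet]⟩

/-- The `j`-th edge at the vertex `k`. -/
def incidentEdge : Fin 3 ⊕ Fin 3 → Fin 3 → K33.edgeSet
  | .inl i, j => edge i j
  | .inr i, j => edge j i

theorem exists_edge (e : K33.edgeSet) : ∃ i j, e = edge i j := by
  obtain ⟨e, he⟩ := e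
  induction e using Sym2.ind with
  | _ x y =>
    rcases x with x | x <;> rcases y with y | y
    · simp [SimpleGraph.mem_edgeSet] at he
    · exact ⟨x, y, rfl⟩
    · exact ⟨y, x, Subtype.ext Sym2.eq_swap⟩
    · simp [SimpleGraph.mem_edgeSet] at he

theorem incidence_edge_inl (k i j : Fin 3) :
    edgeIncidenceMatrix K33 (.inl k) (edge i j) = 1 ↔ k = i := by
  simp [edgeIncidenceMatrix, edge]

theorem incidence_edge_inr (k i j : Fin 3) :
    edgeIncidenceMatrix K33 (.inr k) (edge i j) = 1 ↔ k = j := by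
  simp [edgeIncidenceMatrix, edge]

theorem incidence_incidentEdge (k : Fin 3 ⊕ Fin 3) (j : Fin 3) :
    edgeIncidenceMatrix K33 k (incidentEdge k j) = 1 := by
  rcases k with k | k
  · exact (incidence_edge_inl k k j).2 rfl
  · exact (incidence_edge_inr k j k).2 rfl

theorem edge_injective {i j i' j' : Fin 3} (h : edge i j = edge i' j') : i = i' ∧ j = j' := by
  simpa [edge] using h

/-- The edges at a vertex of `K_{3,3}`. -/
noncomputable def supportEquiv (k : Fin 3 ⊕ Fin 3) :
    Fin 3 ≃ EqnSupport (edgeIncidenceMatrix K33) k :=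
  .ofBijective (fun j => ⟨incidentEdge k j, incidence_incidentEdge k j⟩) <| by
    constructor
    · intro j j' h
      have h := congrArg Subtype.val h
      rcases k with k | k
      · exact (edge_injective h).2
      · exact (edge_injective h).1
    · rintro ⟨e, he⟩
      obtain ⟨i, j, rfl⟩ := exists_edge e
      rcases k with k | k
      · obtain rfl := (incidence_edge_inl _ _ _).1 he
        exact ⟨j, rfl⟩
      · obtain rfl := (incidence_edge_inr _ _ _).1 he
        exact ⟨i, rfl⟩

variable {b b' : Fin 3 ⊕ Fin 3 → ZMod 2}

/-- The satisfying assignments of an equation, as triples of signs. -/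
noncomputable def satEquiv (b : Fin 3 ⊕ Fin 3 → ZMod 2) (k : Fin 3 ⊕ Fin 3) :
    SatAssignment (edgeIncidenceMatrix K33) b k ≃
      {γ : Fin 3 → ℤˣ // ∏ j, γ j = (-1) ^ (b k).val} :=
  ((supportEquiv k).symm.arrowCongr (.refl _)).subtypeEquiv fun α => by
    rw [← (supportEquiv k).prod_comp]
    rfl

/-- The vertices of the colored graph as equations with triples of signs. -/
noncomputable def vertexEquiv (b : Fin 3 ⊕ Fin 3 → ZMod 2) :
    SolVertex (edgeIncidenceMatrix K33) b ≃
      Σ k : Fin 3 ⊕ Fin 3, {γ : Fin 3 → ℤˣ // ∏ j, γ j = (-1) ^ (b k).val} :=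
  Equiv.sigmaCongrRight (satEquiv b)

/-- The sign that a vertex assigns to the `j`-th edge at its equation. -/
noncomputable def sgn (v : SolVertex (edgeIncidenceMatrix K33) b) (j : Fin 3) : ℤˣ :=
  v.2.1 (supportEquiv v.1 j)

theorem prod_sgn (v : SolVertex (edgeIncidenceMatrix K33) b) :
    ∏ j, sgn v j = (-1) ^ (b v.1).val :=
  (vertexEquiv b v).2.2

theorem ext_sgn {v w : SolVertex (edgeIncidenceMatrix K33) b} (h : v.1 = w.1)
    (h' : sgn v = sgn w) : v = w := by
  obtain ⟨k, α⟩ := v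
  obtain ⟨l, β⟩ := w
  obtain rfl : k = l := h
  congr 1
  refine Subtype.ext (funext fun i => ?_)
  obtain ⟨j, rfl⟩ := (supportEquiv k).surjective i
  exact congrFun h' j

theorem exists_sgn_eq (k : Fin 3 ⊕ Fin 3) (γ : Fin 3 → ℤˣ) (h : ∏ j, γ j = (-1) ^ (b k).val) :
    ∃ v : SolVertex (edgeIncidenceMatrix K33) b, v.1 = k ∧ sgn v = γ := by
  refine ⟨(vertexEquiv b).symm ⟨k, γ, h⟩, rfl, ?_⟩
  have := (satEquiv b k).apply_symm_apply ⟨γ, h⟩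
  exact congrArg Subtype.val this

theorem exists_vertex (b : Fin 3 ⊕ Fin 3 → ZMod 2) (k : Fin 3 ⊕ Fin 3) :
    ∃ v : SolVertex (edgeIncidenceMatrix K33) b, v.1 = k := by
  -- One edge carries the whole prescribed product.
  obtain ⟨v, hv, -⟩ := exists_sgn_eq (b := b) k (fun j => if j = 0 then (-1) ^ (b k).val else 1)
    (by simp)
  exact ⟨v, hv⟩

theorem sum_vertex {A : Type*} [AddCommMonoid A] (f : Fin 3 ⊕ Fin 3 → (Fin 3 → ℤˣ) → A) :
    ∑ v : SolVertex (edgeIncidenceMatrix K33) b, f v.1 (sgn v) =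
      ∑ k, ∑ γ with ∏ j, γ j = (-1) ^ (b k).val, f k γ := by
  let g (x : Σ k : Fin 3 ⊕ Fin 3, {γ : Fin 3 → ℤˣ // ∏ j, γ j = (-1) ^ (b k).val}) : A :=
    f x.1 x.2.1
  refine (Fintype.sum_equiv (vertexEquiv b) _ g fun v => rfl).trans ?_
  rw [Fintype.sum_sigma]
  refine Finset.sum_congr rfl fun k _ => ?_
  exact (Finset.sum_subtype (p := fun γ : Fin 3 → ℤˣ => ∏ j, γ j = (-1) ^ (b k).val) _
    (by simp) (f k)).symm

/-! ### Adjacency -/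

theorem edgesOfColor_adj (c : (Σ k, EqnSupport (edgeIncidenceMatrix K33) k → ℤˣ) ⊕ ℤˣ)
    (v w : SolVertex (edgeIncidenceMatrix K33) b) :
    ((GStar (edgeIncidenceMatrix K33) b).edgesOfColor c).Adj v w ↔
      (v ≠ w ∧ (v.1 = w.1 ∨ SolVertex.Disagree v w)) ∧ SolVertex.edgeColorFun v w = c := by
  rw [ColoredGraph.edgesOfColor, SimpleGraph.EdgeLabeling.labelGraph_adj]
  exact ⟨fun ⟨H, h⟩ => ⟨H, h⟩, fun ⟨H, h⟩ => ⟨H, h⟩⟩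

/-- The only edge common to the `i`-th left and the `j`-th right vertex is the `j`-th edge at the
former and the `i`-th at the latter, whence the crossed indices. -/
theorem disagree_of_inl_inr {v w : SolVertex (edgeIncidenceMatrix K33) b} {i j : Fin 3}
    (hv : v.1 = .inl i) (hw : w.1 = .inr j) :
    SolVertex.Disagree v w ↔ sgn v j * sgn w i = -1 := by
  obtain ⟨k, α⟩ := v
  obtain ⟨l, β⟩ := w
  obtain rfl : k = .inl i := hv
  obtain rfl : l = .inr j := hw
  constructor
  · rintro ⟨e, h, h', he⟩
    obtain ⟨p, q, rfl⟩ := exists_edge e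
    obtain rfl := (incidence_edge_inl _ _ _).1 h
    obtain rfl := (incidence_edge_inr _ _ _).1 h'
    exact he
  · intro h
    exact ⟨edge i j, (incidence_edge_inl _ _ _).2 rfl, (incidence_edge_inr _ _ _).2 rfl, h⟩

theorem disagree_comm {v w : SolVertex (edgeIncidenceMatrix K33) b} :
    SolVertex.Disagree v w ↔ SolVertex.Disagree w v := by
  constructor <;> exact fun ⟨i, hx, hy, hi⟩ => ⟨i, hy, hx, by rw [mul_comm]; exact hi⟩

theorem not_disagree_inl_inl {v w : SolVertex (edgeIncidenceMatrix K33) b} {i j : Fin 3}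
    (hv : v.1 = .inl i) (hw : w.1 = .inl j) (hne : i ≠ j) : ¬ SolVertex.Disagree v w := by
  rintro ⟨e, h, h', -⟩
  obtain ⟨p, q, rfl⟩ := exists_edge e
  rw [hv, incidence_edge_inl] at h
  rw [hw, incidence_edge_inl] at h'
  exact hne (h.trans h'.symm)

theorem not_disagree_inr_inr {v w : SolVertex (edgeIncidenceMatrix K33) b} {i j : Fin 3}
    (hv : v.1 = .inr i) (hw : w.1 = .inr j) (hne : i ≠ j) : ¬ SolVertex.Disagree v w := by
  rintro ⟨e, h, h', -⟩
  obtain ⟨p, q, rfl⟩ := exists_edge e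
  rw [hv, incidence_edge_inr] at h
  rw [hw, incidence_edge_inr] at h'
  exact hne (h.trans h'.symm)

theorem edgesOfColor_adj_of_ne {c : (Σ k, EqnSupport (edgeIncidenceMatrix K33) k → ℤˣ) ⊕ ℤˣ}
    {v w : SolVertex (edgeIncidenceMatrix K33) b} (h : v.1 ≠ w.1) :
    ((GStar (edgeIncidenceMatrix K33) b).edgesOfColor c).Adj v w ↔
      SolVertex.Disagree v w ∧ .inr (-1) = c := by
  have hne : v ≠ w := fun e => h (congrArg Sigma.fst e)
  simp [edgesOfColor_adj, h, hne, SolVertex.edgeColorFun]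

theorem edgesOfColor_adj_inl_inr {v w : SolVertex (edgeIncidenceMatrix K33) b} {i j : Fin 3}
    (hv : v.1 = .inl i) (hw : w.1 = .inr j) :
    ((GStar (edgeIncidenceMatrix K33) b).edgesOfColor (.inr (-1))).Adj v w ↔
      sgn v j * sgn w i = -1 := by
  rw [edgesOfColor_adj_of_ne (by simp [hv, hw]), disagree_of_inl_inr hv hw]
  simp

end K33

/-! ### Finite families of projections with sum `1` -/

/-- Compressing the sum by `p j` gives `∑ k, p j * p k * p j = p j`. The term `k = j` is already `p
j`, so the other terms, which are positive, vanish; each is `star (p k * p j) * (p k * p j)`. -/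
theorem IsStarProjection.mul_eq_zero_of_sum_eq_one {ι A : Type*} [Fintype ι] [CStarAlgebra A]
    {p : ι → A} (hp : ∀ i, IsStarProjection (p i)) (h : ∑ i, p i = 1) {i j : ι} (hij : i ≠ j) :
    p i * p j = 0 := by
  classical
  let _ := CStarAlgebra.spectralOrder A
  let _ := CStarAlgebra.spectralOrderedRing A
  have hstar (k : ι) : p j * p k * p j = star (p k * p j) * (p k * p j) := by
    rw [star_mul, (hp j).2.star_eq, (hp k).2.star_eq, mul_assoc, mul_assoc, ← mul_assoc (p k),
      (hp k).1.eq]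
  have hsum : ∑ k, p j * p k * p j = p j := by
    rw [← Finset.sum_mul, ← Finset.mul_sum, h, mul_one, (hp j).1.eq]
  rw [← Finset.add_sum_erase _ _ (Finset.mem_univ j), (hp j).1.eq, (hp j).1.eq,
    add_eq_left, Finset.sum_eq_zero_iff_of_nonneg] at hsum
  · have := hsum i (by simp [hij])
    rwa [hstar, CStarRing.star_mul_self_eq_zero_iff] at this
  · intro k _
    rw [hstar]
    exact star_mul_self_nonneg _

theorem sum_smul_mul_sum_smul_of_orthogonal {ι A : Type*} [Fintype ι] [Ring A] {p : ι → A}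
    (hp : ∀ i, p i * p i = p i) (ho : ∀ i j, i ≠ j → p i * p j = 0) (f g : ι → ℤˣ) :
    (∑ i, f i • p i) * ∑ i, g i • p i = ∑ i, (f i * g i) • p i := by
  rw [Finset.sum_mul_sum]
  refine Finset.sum_congr rfl fun i _ => ?_
  rw [Finset.sum_eq_single i]
  · rw [smul_mul_smul_comm, hp]
  · intro j _ hj
    rw [smul_mul_smul_comm, ho i j hj.symm, smul_zero]
  · simp

/-! ### Operator solutions of an equation in three variables -/

/-- Three operators of square `1` for which the product of any two is, up to the sign `ε`, the
third. -/
structure IsSignTriple {A : Type*} [Ring A] (X : Fin 3 → A) (ε : ℤˣ) : Prop where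
  mul_self : ∀ j, X j * X j = 1
  mul_of_ne : ∀ j l m, j ≠ l → l ≠ m → j ≠ m → X j * X l = ε • X m

namespace K33

variable {b b' : Fin 3 ⊕ Fin 3 → ZMod 2} {A : Type*}

/-- The combination of a family of operators, indexed by the vertices, with the signs of the
vertices, relative to the signs `s`. -/
noncomputable def signSum [Ring A] (s : Fin 3 → ℤˣ) (p : SolVertex (edgeIncidenceMatrix K33) b → A)
    (j : Fin 3) : A :=
  ∑ w, (s j * sgn w j) • p w

theorem mul_of_prod_eq (s : Fin 3 → ℤˣ) {j l m : Fin 3} (h₁ : j ≠ l) (h₂ : l ≠ m) (h₃ : j ≠ m) :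
    s j * s l = (∏ i, s i) * s m := by
  have h : ∀ (s : Fin 3 → ℤˣ) (j l m : Fin 3), j ≠ l → l ≠ m → j ≠ m →
    s j * s l = (∏ i, s i) * s m := by decide
  exact h s j l m h₁ h₂ h₃

/-- The signs `s j * t j` have product `1`, so either none or exactly two of them are `-1`. -/
theorem one_add_sum_mul (s t : Fin 3 → ℤˣ) (h : ∏ i, s i = ∏ i, t i) :
    (1 + ∑ j, ((s j * t j : ℤˣ) : ℤ)) = if s = t then 4 else 0 := by
  revert s t
  decide

/-- Orthogonality makes signed sums multiply coefficientwise. Only vertices of equation `k`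
contribute, and the product of their three signs is constant. -/
theorem isSignTriple_signSum [Ring A] (s : Fin 3 → ℤˣ) (k : Fin 3 ⊕ Fin 3)
    {p : SolVertex (edgeIncidenceMatrix K33) b → A}
    (hp : ∀ w, p w * p w = p w) (ho : ∀ v w, v ≠ w → p v * p w = 0) (h1 : ∑ w, p w = 1)
    (hk : ∀ w, w.1 ≠ k → p w = 0) :
    IsSignTriple (signSum s p) ((∏ j, s j) * (-1) ^ (b k).val) where
  mul_self j := by
    rw [signSum, sum_smul_mul_sum_smul_of_orthogonal hp ho]
    simpa [Int.units_mul_self] using h1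
  mul_of_ne j l m h₁ h₂ h₃ := by
    rw [signSum, signSum, signSum, sum_smul_mul_sum_smul_of_orthogonal hp ho, Finset.smul_sum]
    refine Finset.sum_congr rfl fun w _ => ?_
    by_cases hw : w.1 = k
    · rw [smul_smul, ← hw, ← prod_sgn w]
      congr 1
      rw [mul_mul_mul_comm, mul_of_prod_eq s h₁ h₂ h₃, mul_of_prod_eq (sgn w) h₁ h₂ h₃]
      exact mul_mul_mul_comm _ _ _ _
    · simp [hk w hw]

/-- Fourier inversion: the three signed sums and `1` determine each projection. This carries
commutativity from the square back to `u`. -/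
theorem four_nsmul_eq [Ring A] (s : Fin 3 → ℤˣ) (k : Fin 3 ⊕ Fin 3)
    {p : SolVertex (edgeIncidenceMatrix K33) b → A} (h1 : ∑ w, p w = 1)
    (hk : ∀ w, w.1 ≠ k → p w = 0) {v : SolVertex (edgeIncidenceMatrix K33) b} (hv : v.1 = k) :
    (4 : ℤ) • p v = 1 + ∑ j, (s j * sgn v j) • signSum s p j := by
  have h (j : Fin 3) : (s j * sgn v j) • signSum s p j =
      ∑ w, ((sgn v j * sgn w j : ℤˣ) : ℤ) • p w := by
    rw [signSum, Finset.smul_sum]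
    refine Finset.sum_congr rfl fun w _ => ?_
    rw [smul_smul, mul_mul_mul_comm, Int.units_mul_self, one_mul]
    rfl
  simp only [h]
  rw [Finset.sum_comm, ← h1, ← Finset.sum_add_distrib, Finset.sum_eq_single v]
  · rw [← Finset.sum_smul, ← one_add_zsmul, one_add_sum_mul _ _ rfl, if_pos rfl]
  · intro w _ hw
    by_cases hwk : w.1 = k
    · rw [← Finset.sum_smul, ← one_add_zsmul, one_add_sum_mul, if_neg, zero_smul]
      · exact fun h => hw (ext_sgn (hwk.trans hv.symm) h.symm)
      · rw [prod_sgn, prod_sgn, hv, hwk]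
    · simp [hk w hwk]
  · simp

/-! ### Operator squares -/

/-- A square of operators that satisfies a linear equation for each row and each column. -/
structure IsOperatorSquare [Ring A] (x : Fin 3 → Fin 3 → A) (r c : Fin 3 → ℤˣ) : Prop where
  row : ∀ i, IsSignTriple (x i) (r i)
  col : ∀ j, IsSignTriple (fun i => x i j) (c j)

theorem exists_third {i j : Fin 3} (h : i ≠ j) : ∃ k, j ≠ k ∧ i ≠ k := by
  revert i j
  decide

/-- Homogeneous operator squares are commutative. -/
theorem IsOperatorSquare.commute [Ring A] {x : Fin 3 → Fin 3 → A} (hx : IsOperatorSquare x 1 1)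
    (i j k l : Fin 3) : Commute (x i j) (x k l) := by
  have hrow (i j l m) (h₁ : j ≠ l) (h₂ : l ≠ m) (h₃ : j ≠ m) : x i j * x i l = x i m := by
    simpa using (hx.row i).mul_of_ne j l m h₁ h₂ h₃
  have hcol (i j k n) (h₁ : i ≠ k) (h₂ : k ≠ n) (h₃ : i ≠ n) : x i j * x k j = x n j := by
    simpa using (hx.col j).mul_of_ne i k n h₁ h₂ h₃
  have hsq (i j) : x i j * x i j = 1 := (hx.row i).mul_self j
  by_cases hik : i = k
  · subst hik
    by_cases hjl : j = l
    · subst hjl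
      exact Commute.refl _
    · obtain ⟨m, h₂, h₃⟩ := exists_third hjl
      exact (hrow i j l m hjl h₂ h₃).trans (hrow i l j m (Ne.symm hjl) h₃ h₂).symm
  · obtain ⟨n, hkn, hin⟩ := exists_third hik
    by_cases hjl : j = l
    · subst hjl
      exact (hcol i j k n hik hkn hin).trans (hcol k j i n (Ne.symm hik) hin hkn).symm
    · obtain ⟨m, hlm, hjm⟩ := exists_third hjl
      -- With third indices `m` and `n`, both factors are split so that a common middle operator of
      -- square `1` cancels. Two such exchanges on `x i j * x k l` and one on `x k l * x i j` end in
      -- the same product.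
      have e₁ : x i j * x k l = x i m * x n l := by
        rw [← hrow i m l j hlm.symm (Ne.symm hjl) hjm.symm, ← hcol i l n k hin hkn.symm hik,
          mul_assoc, ← mul_assoc (x i l) (x i l), hsq, one_mul]
      have e₂ : x i m * x n l = x k m * x n j := by
        rw [← hcol k m n i hkn hin.symm (Ne.symm hik), ← hrow n m j l hjm.symm hjl hlm.symm,
          mul_assoc, ← mul_assoc (x n m) (x n m), hsq, one_mul]
      have e₃ : x k l * x i j = x k m * x n j := by
        rw [← hrow k m j l hjm.symm hjl hlm.symm, ← hcol k j n i hkn hin.symm (Ne.symm hik),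
          mul_assoc, ← mul_assoc (x k j) (x k j), hsq, one_mul]
      exact (e₁.trans e₂).trans e₃.symm

theorem IsOperatorSquare.prod_eq_prod {x : Fin 3 → Fin 3 → ℂ} {r c : Fin 3 → ℤˣ}
    (hx : IsOperatorSquare x r c) : ∏ i, r i = ∏ j, c j := by
  have key {X : Fin 3 → ℂ} {ε : ℤˣ} (h : IsSignTriple X ε) : ∏ j, X j = ((ε : ℤ) : ℂ) := by
    rw [Fin.prod_univ_three, h.mul_of_ne 0 1 2 (by decide) (by decide) (by decide), smul_mul_assoc,
      h.mul_self, Units.smul_def, zsmul_one]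
  have h : ∏ i, (((r i : ℤˣ) : ℤ) : ℂ) = ∏ j, (((c j : ℤˣ) : ℤ) : ℂ) := by
    simp only [← key (hx.row _), ← key (hx.col _)]
    exact Finset.prod_comm
  exact Units.ext (by push_cast; exact_mod_cast h)

end K33

/-! ### The operator square of an intertwiner -/

/-- Turns a signed sum into a sum over the terms of sign `-1`. In the application these are the
neighbors along edges of color `-1`, so the intertwining relation applies. -/
theorem sum_units_smul_eq {ι A : Type*} [Fintype ι] [Ring A] (f : ι → ℤˣ) (p : ι → A) :
    ∑ i, f i • p i = ∑ i, p i - 2 * ∑ i, if f i = -1 then p i else 0 := by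
  rw [Finset.mul_sum, ← Finset.sum_sub_distrib]
  refine Finset.sum_congr rfl fun i _ => ?_
  rcases Int.units_eq_one_or (f i) with h | h
  · simp [h]
  · rw [h, if_pos rfl, Units.neg_smul, one_smul]
    noncomm_ring

namespace K33

open ColoredGraph

variable {b b' : Fin 3 ⊕ Fin 3 → ZMod 2} {A : Type*} [CStarAlgebra A]
  {u : Matrix (SolVertex (edgeIncidenceMatrix K33) b) (SolVertex (edgeIncidenceMatrix K33) b') A}

theorem Intertwines.row_isSignTriple
    (hu : (GStar (edgeIncidenceMatrix K33) b).Intertwines (GStar (edgeIncidenceMatrix K33) b') u)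
    (v : SolVertex (edgeIncidenceMatrix K33) b) :
    IsSignTriple (signSum (sgn v) (u v)) ((-1) ^ (b v.1).val * (-1) ^ (b' v.1).val) := by
  rw [← prod_sgn v]
  exact isSignTriple_signSum (sgn v) v.1 (fun w => (hu.isStarProjection v w).1)
    (fun _ _ h => IsStarProjection.mul_eq_zero_of_sum_eq_one (hu.isStarProjection v)
      (hu.row_sum v) h)
    (hu.row_sum v) fun w h => hu.color v w h.symm

theorem Intertwines.col_isSignTriple
    (hu : (GStar (edgeIncidenceMatrix K33) b).Intertwines (GStar (edgeIncidenceMatrix K33) b') u)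
    (w : SolVertex (edgeIncidenceMatrix K33) b') :
    IsSignTriple (signSum (sgn w) fun v => u v w)
      ((-1) ^ (b w.1).val * (-1) ^ (b' w.1).val) := by
  rw [mul_comm, ← prod_sgn w]
  exact isSignTriple_signSum (sgn w) w.1 (fun v => (hu.isStarProjection v w).1)
    (fun _ _ h => IsStarProjection.mul_eq_zero_of_sum_eq_one
      (fun v => hu.isStarProjection v w) (hu.col_sum w) h)
    (hu.col_sum w) fun v h => hu.color v w h

/-- After the common factor `sgn v j * sgn w i` is taken out, both sides are `1` minus twice a sum
of entries of `u`. The two sums are the `(v, w)` entries of the two sides of the intertwining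
relation for color `-1`. -/
theorem Intertwines.signSum_row_eq_signSum_col
    (hu : (GStar (edgeIncidenceMatrix K33) b).Intertwines (GStar (edgeIncidenceMatrix K33) b') u)
    {v : SolVertex (edgeIncidenceMatrix K33) b} {w : SolVertex (edgeIncidenceMatrix K33) b'}
    {i j : Fin 3} (hv : v.1 = .inl i) (hw : w.1 = .inr j) :
    signSum (sgn v) (u v) j = signSum (sgn w) (fun v' => u v' w) i := by
  have hadj := congrFun (congrFun (hu.adj (.inr (-1))) v) w
  simp only [Matrix.mul_apply, colorAdjMatrix, SimpleGraph.adjMatrix_apply, ite_mul, one_mul,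
    zero_mul, mul_ite, mul_one, mul_zero] at hadj
  have hl : signSum (sgn v) (u v) j =
      (sgn v j * sgn w i) • ∑ w', (sgn w' j * sgn w i) • u v w' := by
    rw [signSum, Finset.smul_sum]
    refine Finset.sum_congr rfl fun w' _ => ?_
    rw [smul_smul, mul_comm (sgn w' j), mul_assoc, ← mul_assoc (sgn w i),
      Int.units_mul_self, one_mul]
  have hr : signSum (sgn w) (fun v' => u v' w) i =
      (sgn v j * sgn w i) • ∑ v', (sgn v j * sgn v' i) • u v' w := by
    rw [signSum, Finset.smul_sum]
    refine Finset.sum_congr rfl fun v' _ => ?_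
    rw [smul_smul, mul_mul_mul_comm, Int.units_mul_self, one_mul]
  rw [hl, hr, sum_units_smul_eq, sum_units_smul_eq, hu.row_sum, hu.col_sum]
  congr 3
  symm
  convert hadj using 2
  · rename_i v' _
    by_cases h : v'.1 = .inr j
    · simp [edgesOfColor_adj_inl_inr hv h]
    · have : u v' w = 0 := hu.color v' w fun e => h (Eq.trans e hw)
      simp [this]
  · rename_i w' _
    by_cases h : w'.1 = .inl i
    · simp [edgesOfColor_adj_inl_inr h hw]
    · have : u v w' = 0 := hu.color v w' fun e => h (Eq.trans e.symm hv)
      simp [this]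

/-- The operators that an intertwiner assigns to the edges form an operator square. -/
theorem Intertwines.exists_isOperatorSquare
    (hu : (GStar (edgeIncidenceMatrix K33) b).Intertwines (GStar (edgeIncidenceMatrix K33) b') u) :
    ∃ x : Fin 3 → Fin 3 → A,
      IsOperatorSquare x (fun i => (-1) ^ (b (.inl i)).val * (-1) ^ (b' (.inl i)).val)
        (fun j => (-1) ^ (b (.inr j)).val * (-1) ^ (b' (.inr j)).val) ∧
      (∀ i v, v.1 = .inl i → signSum (sgn v) (u v) = x i) ∧
      ∀ j w, w.1 = .inr j → signSum (sgn w) (fun v => u v w) = fun i => x i j := by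
  -- Any row at a left equation can be compared with any column at a right one, so fixed
  -- representatives show independence of the vertex.
  choose v₀ hv₀ using exists_vertex b
  choose w₀ hw₀ using exists_vertex b'
  have hcol (j w) (hw : w.1 = .inr j) : signSum (sgn w) (fun v => u v w) =
      fun i => signSum (sgn (v₀ (.inl i))) (u (v₀ (.inl i))) j :=
    funext fun i => (signSum_row_eq_signSum_col hu (hv₀ _) hw).symm
  refine ⟨fun i => signSum (sgn (v₀ (.inl i))) (u (v₀ (.inl i))), ⟨fun i => ?_, fun j => ?_⟩,
    fun i v hv => funext fun j => ?_, hcol⟩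
  · have := row_isSignTriple hu (v₀ (.inl i))
    rwa [hv₀] at this
  · have := col_isSignTriple hu (w₀ (.inr j))
    rwa [hcol j _ (hw₀ _), hw₀] at this
  · exact (signSum_row_eq_signSum_col hu hv (hw₀ (.inr j))).trans
      (signSum_row_eq_signSum_col hu (hv₀ _) (hw₀ (.inr j))).symm

theorem Commute.of_four_zsmul {R : Type*} [Ring R] [Algebra ℂ R] {p y : R}
    (h : Commute ((4 : ℤ) • p) y) : Commute p y := by
  have h4 : (4 : ℤ) • p = (4 : ℂ) • p := by
    rw [← Int.cast_smul_eq_zsmul ℂ]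
    norm_num
  rw [h4] at h
  simpa using h.smul_left ((4 : ℂ)⁻¹)

theorem Intertwines.commute
    {u : Matrix (SolVertex (edgeIncidenceMatrix K33) b) (SolVertex (edgeIncidenceMatrix K33) b) A}
    (hu : (GStar (edgeIncidenceMatrix K33) b).Intertwines (GStar (edgeIncidenceMatrix K33) b) u)
    (v w v' w' : SolVertex (edgeIncidenceMatrix K33) b) : Commute (u v w) (u v' w') := by
  obtain ⟨x, hx, hrow, hcol⟩ := exists_isOperatorSquare hu
  simp only [Int.units_mul_self] at hx
  -- Used twice: first to pass from the operators of the square to one entry of `u`, then to a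
  -- second entry.
  have key (y : A) (hy : ∀ i j, Commute (x i j) y) (v w) : Commute (u v w) y := by
    by_cases hvw : v.1 = w.1
    · apply Commute.of_four_zsmul
      rcases hk : v.1 with i | j
      · rw [four_nsmul_eq (sgn v) (.inl i) (hu.row_sum v)
          (fun w h => hu.color v w fun e => h (Eq.trans e.symm hk)) (hvw.symm.trans hk),
          hrow i v hk]
        exact (Commute.one_left y).add_left
          (.sum_left _ _ _ fun j _ => (hy i j).smul_left _)
      · rw [four_nsmul_eq (p := fun v => u v w) (sgn w) (.inr j) (hu.col_sum w)
          (fun v h => hu.color v w fun e => h (Eq.trans e (hvw.symm.trans hk))) hk,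
          hcol j w (hvw.symm.trans hk)]
        exact (Commute.one_left y).add_left
          (.sum_left _ _ _ fun i _ => (hy i j).smul_left _)
    · rw [hu.color v w hvw]
      exact Commute.zero_left y
  exact key _ (fun i j => (key _ (fun k l => hx.commute k l i j) v' w').symm) v w

end K33

/-! ### Quantum symmetry and isomorphism -/

namespace ColoredGraph

theorem not_hasQuantumSymmetry_of_commute {V C D : Type} [Fintype V] {G : ColoredGraph V C D}
    (h : ∀ i j k l, Commute (Qut.u G i j) (Qut.u G k l)) : ¬ G.HasQuantumSymmetry := by
  intro hG
  refine hG fun a b => Subtype.ext ?_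
  -- Commutativity of the generated star algebra also requires generators to commute with adjoints
  -- of generators.
  have hself (x) (hx : x ∈ Set.range fun p : V × V => QutRep.gen G p.1 p.2) : star x = x := by
    obtain ⟨p, rfl⟩ := hx
    exact congrArg Subtype.val ((Qut.intertwines_u G).isStarProjection p.1 p.2).2.star_eq
  have hcomm (x) (hx : x ∈ Set.range fun p : V × V => QutRep.gen G p.1 p.2)
      (y) (hy : y ∈ Set.range fun p : V × V => QutRep.gen G p.1 p.2) : x * y = y * x := by
    obtain ⟨p, rfl⟩ := hx
    obtain ⟨q, rfl⟩ := hy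
    exact congrArg Subtype.val (h p.1 p.2 q.1 q.2).eq
  have := StarAlgebra.isMulCommutative_adjoin ℂ hcomm
    (fun x hx y hy => by rw [hself y hy]; exact hcomm x hx y hy)
  let _ := StarSubalgebra.commRingTopologicalClosure
    (StarAlgebra.adjoin ℂ (Set.range fun p : V × V => QutRep.gen G p.1 p.2))
    this.is_comm.comm
  have hc : ∀ a b : (StarAlgebra.adjoin ℂ
      (Set.range fun p : V × V => QutRep.gen G p.1 p.2)).topologicalClosure, a * b = b * a :=
    mul_comm
  exact congrArg Subtype.val (hc a b)

open Classical in
/-- The permutation matrix of an isomorphism of colored graphs is an intertwiner. -/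
theorem Isomorphic.exists_intertwines {V V' C D : Type} [Fintype V] [Fintype V']
    {G : ColoredGraph V C D} {G' : ColoredGraph V' C D} (h : G.Isomorphic G') :
    ∃ u : Matrix V V' ℂ, G.Intertwines G' u := by
  obtain ⟨f, hf, hc⟩ := h
  have hadj (d : D) (v w : V) :
      (G'.edgesOfColor d).Adj (f v) (f w) ↔ (G.edgesOfColor d).Adj v w := by
    simp only [edgesOfColor, SimpleGraph.EdgeLabeling.labelGraph_adj]
    constructor
    · rintro ⟨H, hd⟩
      exact ⟨f.map_adj_iff.1 H, (hc v w _).symm.trans hd⟩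
    · rintro ⟨H, hd⟩
      exact ⟨f.map_adj_iff.2 H, (hc v w H).trans hd⟩
  refine ⟨.of fun v w => if f v = w then 1 else 0, ⟨fun v w => ?_, fun v => ?_, fun w => ?_,
    fun v w hvw => ?_, fun d => ?_⟩⟩
  · rw [Matrix.of_apply]
    split_ifs
    exacts [.one _, .zero _]
  · simp
  · obtain ⟨v, rfl⟩ := f.surjective w
    simp
  · rw [Matrix.of_apply, if_neg]
    rintro rfl
    exact hvw (hf v).symm
  · ext v w
    obtain ⟨w, rfl⟩ := f.surjective w
    simp only [Matrix.mul_apply, colorAdjMatrix, SimpleGraph.adjMatrix_apply, Matrix.of_apply]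
    rw [Finset.sum_eq_single (f v) (by simp +contextual [eq_comm]) (by simp)]
    simp [hadj]

end ColoredGraph

namespace K33

theorem not_isomorphic {b b' : Fin 3 ⊕ Fin 3 → ZMod 2}
    (h : ∏ k, (-1 : ℤˣ) ^ (b k).val * (-1) ^ (b' k).val = -1) :
    ¬ (GStar (edgeIncidenceMatrix K33) b).Isomorphic (GStar (edgeIncidenceMatrix K33) b') := by
  intro hiso
  obtain ⟨u, hu⟩ := hiso.exists_intertwines
  obtain ⟨x, hx, -⟩ := Intertwines.exists_isOperatorSquare hu
  rw [Fintype.prod_sum_type, hx.prod_eq_prod, Int.units_mul_self] at h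
  exact absurd h (by decide)

theorem not_hasQuantumSymmetry (b : Fin 3 ⊕ Fin 3 → ZMod 2) :
    ¬ (GStar (edgeIncidenceMatrix K33) b).HasQuantumSymmetry :=
  ColoredGraph.not_hasQuantumSymmetry_of_commute
    (Intertwines.commute (ColoredGraph.Qut.intertwines_u _))

end K33

/-! ### Strategies that use a maximally entangled state -/

-- The transpose trick: on a multiple of the maximally entangled vector, `Fᵀ` on the second factor
-- acts as `F` on the first, which leaves a trace.
open scoped Kronecker in
theorem inner_kronecker_maximallyEntangled {n : Type} [Fintype n] [DecidableEq n] (c : ℂ)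
    (E F : Matrix n n ℂ) :
    inner ℂ (WithLp.toLp 2 fun p : n × n => if p.1 = p.2 then c else 0)
      (Matrix.toEuclideanCLM (𝕜 := ℂ) (E ⊗ₖ (1 : Matrix n n ℂ))
        (Matrix.toEuclideanCLM (𝕜 := ℂ) ((1 : Matrix n n ℂ) ⊗ₖ F.transpose)
          (WithLp.toLp 2 fun p : n × n => if p.1 = p.2 then c else 0))) =
      star c * c * (E * F).trace := by
  rw [← mul_apply_eq_comp, ← map_mul, ← Matrix.mul_kronecker_mul, mul_one, one_mul,
    Matrix.toEuclideanCLM_toLp, EuclideanSpace.inner_toLp_toLp]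
  simp only [dotProduct, Matrix.mulVec, Fintype.sum_prod_type, Matrix.kroneckerMap_apply,
    Matrix.transpose_apply, Matrix.trace, Matrix.diag_apply, Matrix.mul_apply, Pi.star_apply,
    mul_ite, mul_zero, Finset.sum_ite_eq, Finset.mem_univ, if_true, apply_ite star, star_zero]
  simp only [Finset.mul_sum]
  refine Finset.sum_congr rfl fun i _ => ?_
  rw [Finset.sum_mul]
  refine Finset.sum_congr rfl fun j _ => ?_
  ring

namespace ColoredGraph

variable {V V' C D : Type}

/-- The operator of the answer `y` to the input `x` in the isomorphism game. -/
def playOperator {A : Type*} [Zero A] (u : V → V' → A) : V ⊕ V' → V ⊕ V' → A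
  | .inl v, .inr w => u v w
  | .inr w, .inl v => u v w
  | _, _ => 0

variable [Fintype V] [Fintype V']

theorem sum_playOperator {A : Type*} [AddCommMonoid A] [One A] {u : V → V' → A}
    (hr : ∀ v, ∑ w, u v w = 1) (hc : ∀ w, ∑ v, u v w = 1) (x : V ⊕ V') :
    ∑ y, playOperator u x y = 1 := by
  rcases x with v | w
  · simp [playOperator, hr]
  · simp [playOperator, hc]

open scoped Kronecker in
/-- A matrix of projections in a matrix algebra that vanishes on incompatible pairs of vertices
gives a perfect quantum strategy. -/
theorem quantumIsomorphic_of_projections {n : Type} [Fintype n] [DecidableEq n] [Nonempty n]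
    (G : ColoredGraph V C D) (G' : ColoredGraph V' C D) (u : V → V' → Matrix n n ℂ)
    (hu : ∀ v w, IsStarProjection (u v w)) (hr : ∀ v, ∑ w, u v w = 1)
    (hc : ∀ w, ∑ v, u v w = 1) (hcol : ∀ v w, u v w ≠ 0 → G.vertexColor v = G'.vertexColor w)
    (hadj : ∀ v w v' w', u v w * u v' w' ≠ 0 → (v = v' ↔ w = w') ∧
      ∀ d, (G.edgesOfColor d).Adj v v' ↔ (G'.edgesOfColor d).Adj w w') :
    G.QuantumIsomorphic G' := by
  classical
  have hP (x y : V ⊕ V') : IsStarProjection (playOperator u x y) := by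
    rcases x with v | w <;> rcases y with v' | w'
    exacts [.zero _, hu _ _, hu _ _, .zero _]
  have hplay (x y : V ⊕ V') (h : playOperator u x y ≠ 0) :
      ∃ v w, IsPlay x y v w ∧ playOperator u x y = u v w := by
    rcases x with v | w <;> rcases y with v' | w'
    · exact absurd rfl h
    · exact ⟨v, w', .inl ⟨rfl, rfl⟩, rfl⟩
    · exact ⟨v', w, .inr ⟨rfl, rfl⟩, rfl⟩
    · exact absurd rfl h
  have hwins (x x' y y' : V ⊕ V') (h : ¬ Wins G G' x x' y y') :
      playOperator u x y * playOperator u x' y' = 0 := by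
    by_contra hne
    obtain ⟨v, w, hvw, e⟩ := hplay x y (left_ne_zero_of_mul hne)
    obtain ⟨v', w', hvw', e'⟩ := hplay x' y' (right_ne_zero_of_mul hne)
    rw [e, e'] at hne
    exact h ⟨v, v', w, w', hvw, hvw', ⟨hcol _ _ (left_ne_zero_of_mul hne),
      hcol _ _ (right_ne_zero_of_mul hne)⟩, hadj _ _ _ _ hne⟩
  -- The normalization `1 / √n` of the maximally entangled vector.
  obtain ⟨c, hcn⟩ : ∃ c : ℂ, star c * c * (Fintype.card n : ℂ) = 1 := by
    refine ⟨((Real.sqrt (Fintype.card n))⁻¹ : ℝ), ?_⟩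
    have h : (0 : ℝ) < Fintype.card n := by exact_mod_cast Fintype.card_pos
    rw [RCLike.star_def, Complex.conj_ofReal, ← Complex.ofReal_natCast, ← Complex.ofReal_mul,
      ← Complex.ofReal_mul, ← mul_inv, Real.mul_self_sqrt h.le, inv_mul_cancel₀ h.ne',
      Complex.ofReal_one]
  let ψ : EuclideanSpace ℂ (n × n) := WithLp.toLp 2 fun p => if p.1 = p.2 then c else 0
  have hψ : ‖ψ‖ = 1 := by
    have h := inner_kronecker_maximallyEntangled c (1 : Matrix n n ℂ) 1
    rw [Matrix.transpose_one, Matrix.one_kronecker_one, map_one, mul_one, Matrix.trace_one, hcn,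
      one_apply_eq_self, one_apply_eq_self] at h
    have h' : inner ℂ ψ ψ = (1 : ℂ) := h
    rw [inner_self_eq_norm_sq_to_K] at h'
    exact (pow_eq_one_iff_of_nonneg (norm_nonneg ψ) two_ne_zero).1
      (Complex.ofReal_injective (by simpa using h'))
  let L : Matrix n n ℂ →+ (EuclideanSpace ℂ (n × n) →L[ℂ] EuclideanSpace ℂ (n × n)) :=
    { toFun E := Matrix.toEuclideanCLM (𝕜 := ℂ) (E ⊗ₖ (1 : Matrix n n ℂ))
      map_zero' := by simp
      map_add' E F := by simp [Matrix.add_kronecker] }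
  let R : Matrix n n ℂ →+ (EuclideanSpace ℂ (n × n) →L[ℂ] EuclideanSpace ℂ (n × n)) :=
    { toFun F := Matrix.toEuclideanCLM (𝕜 := ℂ) ((1 : Matrix n n ℂ) ⊗ₖ F.transpose)
      map_zero' := by simp
      map_add' E F := by simp [Matrix.kronecker_add] }
  have hL1 : L 1 = 1 := by simp [L]
  have hR1 : R 1 = 1 := by simp [R]
  have hLpos (E : Matrix n n ℂ) (hE : IsStarProjection E) : (L E).IsPositive := by
    refine ContinuousLinearMap.IsPositive.of_isStarProjection
      (IsStarProjection.map ⟨?_, ?_⟩ (Matrix.toEuclideanCLM (𝕜 := ℂ)))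
    · rw [IsIdempotentElem, ← Matrix.mul_kronecker_mul, hE.1.eq, mul_one]
    · rw [isSelfAdjoint_iff, Matrix.star_eq_conjTranspose, Matrix.conjTranspose_kronecker,
        ← Matrix.star_eq_conjTranspose, hE.2.star_eq, Matrix.conjTranspose_one]
  have hRpos (F : Matrix n n ℂ) (hF : IsStarProjection F) : (R F).IsPositive := by
    refine ContinuousLinearMap.IsPositive.of_isStarProjection
      (IsStarProjection.map ⟨?_, ?_⟩ (Matrix.toEuclideanCLM (𝕜 := ℂ)))
    · rw [IsIdempotentElem, ← Matrix.mul_kronecker_mul, ← Matrix.transpose_mul, hF.1.eq, mul_one]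
    · rw [isSelfAdjoint_iff, Matrix.star_eq_conjTranspose, Matrix.conjTranspose_kronecker,
        show F.transpose.conjTranspose = F.conjTranspose.transpose from rfl,
        ← Matrix.star_eq_conjTranspose F, hF.2.star_eq,
        Matrix.conjTranspose_one]
  let S : CommutingStrategy (V ⊕ V') (EuclideanSpace ℂ (n × n)) :=
    { ψ := ψ
      norm_ψ := hψ
      alice := fun x y => L (playOperator u x y)
      alice_pos := fun x y => hLpos _ (hP x y)
      alice_sum := fun x => by rw [← map_sum, sum_playOperator hr hc, hL1]
      bob := fun x y => R (playOperator u x y)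
      bob_pos := fun x y => hRpos _ (hP x y)
      bob_sum := fun x => by rw [← map_sum, sum_playOperator hr hc, hR1]
      commute := fun x y x' y' => by
        refine Commute.map (f := Matrix.toEuclideanCLM (𝕜 := ℂ)) ?_
        rw [Commute, SemiconjBy, ← Matrix.mul_kronecker_mul, ← Matrix.mul_kronecker_mul, mul_one,
          one_mul, mul_one, one_mul] }
  have hS (x x' y y' : V ⊕ V') : S.prob x x' y y' =
      (star c * c * (playOperator u x y * playOperator u x' y').trace).re :=
    congrArg Complex.re (inner_kronecker_maximallyEntangled c _ _)
  refine ⟨EuclideanSpace ℂ (n × n), _, _, inferInstance, S, fun x x' => ?_⟩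
  -- Losing answers have operators with product `0`, so the winning condition can be dropped; the
  -- sum over all answers is the normalized trace of `1`.
  have h (y y' : V ⊕ V') : (if Wins G G' x x' y y' then S.prob x x' y y' else 0) =
      (star c * c * (playOperator u x y * playOperator u x' y').trace).re := by
    split_ifs with hw
    · exact hS x x' y y'
    · simp [hwins x x' y y' hw]
  simp only [h]
  simp only [← Complex.re_sum, ← Finset.mul_sum, ← Matrix.trace_sum, sum_playOperator hr hc,
    mul_one, Matrix.trace_one, hcn, Complex.one_re]

end ColoredGraph

/-! ### Operator squares give quantum isomorphisms -/

/-- The joint spectral projection of a sign triple for the eigenvalues `s`. -/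
noncomputable def signProj {A : Type*} [Ring A] [Algebra ℂ A] (X : Fin 3 → A) (s : Fin 3 → ℤˣ) :
    A :=
  (4⁻¹ : ℂ) • (1 + ∑ j, s j • X j)

theorem exists_sum_eq_of_fin_three (j : Fin 3) : ∃ l m : Fin 3, j ≠ l ∧ l ≠ m ∧ j ≠ m ∧
    ∀ {A : Type*} [AddCommMonoid A] (f : Fin 3 → A), ∑ i, f i = f j + f l + f m := by
  fin_cases j
  · exact ⟨1, 2, by decide, by decide, by decide, fun f => Fin.sum_univ_three f⟩
  · refine ⟨2, 0, by decide, by decide, by decide, fun f => (Fin.sum_univ_three f).trans ?_⟩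
    exact (add_assoc _ _ _).trans (add_comm _ _)
  · refine ⟨0, 1, by decide, by decide, by decide, fun f => (Fin.sum_univ_three f).trans ?_⟩
    exact (add_comm _ _).trans (add_assoc _ _ _).symm

namespace IsSignTriple

variable {A : Type*} [Ring A] [Algebra ℂ A] {X : Fin 3 → A} {ε : ℤˣ} {s : Fin 3 → ℤˣ}

/-- Multiplication by `X j` exchanges `1` with `X j` and the other two operators with each other; `∏
i, s i = ε` makes the coefficients match. -/
theorem mul_signProj (hX : IsSignTriple X ε) (hs : ∏ i, s i = ε) (j : Fin 3) :
    X j * signProj X s = s j • signProj X s := by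
  obtain ⟨l, m, h₁, h₂, h₃, hsum⟩ := exists_sum_eq_of_fin_three j
  have hl : s j * s l = ε * s m := hs ▸ K33.mul_of_prod_eq s h₁ h₂ h₃
  have hm : s j * s m = ε * s l := hs ▸ K33.mul_of_prod_eq s h₃ h₂.symm h₁
  rw [signProj, mul_smul_comm, smul_comm (s j)]
  congr 1
  rw [hsum]
  simp only [mul_add, mul_one, mul_smul_comm, smul_add, hX.mul_self,
    hX.mul_of_ne j l m h₁ h₂ h₃, hX.mul_of_ne j m l h₃ h₂.symm h₁, smul_smul, Int.units_mul_self,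
    one_smul, hl, hm, mul_comm _ ε]
  abel

theorem signProj_mul (hX : IsSignTriple X ε) (hs : ∏ i, s i = ε) (j : Fin 3) :
    signProj X s * X j = s j • signProj X s := by
  rw [← hX.mul_signProj hs, signProj, smul_mul_assoc, mul_smul_comm, add_mul, mul_add, one_mul,
    mul_one, Finset.sum_mul, Finset.mul_sum]
  congr 2
  refine Finset.sum_congr rfl fun l _ => ?_
  rw [smul_mul_assoc, mul_smul_comm]
  congr 1
  by_cases hjl : j = l
  · rw [hjl]
  · obtain ⟨m, h₂, h₃⟩ := K33.exists_third hjl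
    rw [hX.mul_of_ne j l m hjl h₂ h₃, hX.mul_of_ne l j m (Ne.symm hjl) h₃ h₂]

theorem isStarProjection_signProj [StarRing A] [StarModule ℂ A] (hX : IsSignTriple X ε)
    (hs : ∏ i, s i = ε) (hsa : ∀ j, IsSelfAdjoint (X j)) : IsStarProjection (signProj X s) := by
  constructor
  · rw [IsIdempotentElem]
    nth_rw 1 [signProj]
    rw [smul_mul_assoc, add_mul, one_mul, Finset.sum_mul]
    -- Each of the three terms acts on the joint eigenspace as `1`, so the bracket acts as `4`.
    simp only [smul_mul_assoc, hX.mul_signProj hs, smul_smul, Int.units_mul_self, one_smul,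
      Finset.sum_const, Finset.card_univ, Fintype.card_fin]
    rw [← Nat.cast_smul_eq_nsmul ℂ]
    module
  · rw [isSelfAdjoint_iff, signProj, star_smul, star_add, star_one, star_sum]
    congr 1
    · simp
    · congr 1
      refine Finset.sum_congr rfl fun j _ => ?_
      rw [Units.smul_def, star_zsmul, (hsa j).star_eq]

end IsSignTriple

/-- There are four sign triples with product `ε`, and in each position their signs cancel. -/
theorem sum_signProj {A : Type*} [Ring A] [Algebra ℂ A] (X : Fin 3 → A) (s : Fin 3 → ℤˣ)
    (ε : ℤˣ) : ∑ γ : Fin 3 → ℤˣ with ∏ j, γ j = ε, signProj X (fun j => s j * γ j) = 1 := by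
  have hcard : ∀ ε : ℤˣ, (Finset.univ.filter fun γ : Fin 3 → ℤˣ => ∏ j, γ j = ε).card = 4 := by
    decide
  have hzero : ∀ (ε : ℤˣ) (j : Fin 3),
      ∑ γ : Fin 3 → ℤˣ with ∏ j, γ j = ε, ((γ j : ℤˣ) : ℤ) = 0 := by
    decide
  simp only [signProj]
  rw [← Finset.smul_sum, Finset.sum_add_distrib, Finset.sum_const, hcard, Finset.sum_comm,
    Finset.sum_eq_zero, add_zero, ← Nat.cast_smul_eq_nsmul ℂ, smul_smul]
  · norm_num
  · intro j _
    simp only [mul_smul]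
    rw [← Finset.smul_sum]
    simp only [Units.smul_def (_ : ℤˣ) (X j)]
    rw [← Finset.sum_smul, hzero, zero_smul, smul_zero]

/-- Evaluate `P * X * Q` from both sides: eigenvectors for different eigenvalues are orthogonal. -/
theorem mul_eq_zero_of_sign_ne {A : Type*} [Ring A] [Algebra ℂ A] {P Q X : A} {s t : ℤˣ}
    (hP : P * X = s • P) (hQ : X * Q = t • Q) (h : s ≠ t) : P * Q = 0 := by
  have e : s • (P * Q) = t • (P * Q) := by
    rw [← smul_mul_assoc, ← hP, mul_assoc, hQ, mul_smul_comm]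
  obtain rfl : s = -t := (Int.units_ne_iff_eq_neg).1 h
  rw [Units.neg_smul, ← smul_neg, smul_left_cancel_iff, neg_eq_iff_add_eq_zero, ← two_smul ℂ,
    smul_eq_zero] at e
  exact e.resolve_left two_ne_zero

namespace K33

variable {b b' : Fin 3 ⊕ Fin 3 → ZMod 2}

/-- The operators of an equation. -/
def equationOperator {A : Type*} (x : Fin 3 → Fin 3 → A) : Fin 3 ⊕ Fin 3 → Fin 3 → A
  | .inl i, j => x i j
  | .inr j, i => x i j

theorem mul_eq_mul_of_mul_eq_mul {a b c d : ℤˣ} (h : a * b = c * d) : a * c = b * d := by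
  revert a b c d
  decide

theorem edgeColorFun_eq {v v' : SolVertex (edgeIncidenceMatrix K33) b}
    {w w' : SolVertex (edgeIncidenceMatrix K33) b'} (hv : v.1 = v'.1) (hw : w.1 = w'.1)
    (hvw : v.1 = w.1) (h : ∀ j, sgn v j * sgn v' j = sgn w j * sgn w' j) :
    SolVertex.edgeColorFun v v' = SolVertex.edgeColorFun w w' := by
  obtain ⟨k, α⟩ := v
  obtain ⟨_, α'⟩ := v'
  obtain ⟨_, β⟩ := w
  obtain ⟨_, β'⟩ := w'
  obtain rfl := hv
  obtain rfl := hw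
  obtain rfl := hvw
  simp only [SolVertex.edgeColorFun, dif_pos]
  congr 2
  funext i
  obtain ⟨j, rfl⟩ := (supportEquiv k).surjective i
  exact h j

open ColoredGraph in
theorem quantumIsomorphic_of_isOperatorSquare {n : Type} [Fintype n] [DecidableEq n] [Nonempty n]
    {x : Fin 3 → Fin 3 → Matrix n n ℂ}
    (hx : IsOperatorSquare x (fun i => (-1) ^ (b (.inl i)).val * (-1) ^ (b' (.inl i)).val)
      (fun j => (-1) ^ (b (.inr j)).val * (-1) ^ (b' (.inr j)).val))
    (hsa : ∀ i j, IsSelfAdjoint (x i j)) :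
    (GStar (edgeIncidenceMatrix K33) b).QuantumIsomorphic (GStar (edgeIncidenceMatrix K33) b') := by
  have hX (k) : IsSignTriple (equationOperator x k) ((-1) ^ (b k).val * (-1) ^ (b' k).val) := by
    rcases k with i | j
    · exact hx.row i
    · exact hx.col j
  have hXsa (k j) : IsSelfAdjoint (equationOperator x k j) := by
    rcases k with i | i
    · exact hsa i j
    · exact hsa j i
  let P (v : SolVertex (edgeIncidenceMatrix K33) b) (w : SolVertex (edgeIncidenceMatrix K33) b') :
      Matrix n n ℂ := signProj (equationOperator x v.1) fun j => sgn v j * sgn w j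
  have hprod (v : SolVertex (edgeIncidenceMatrix K33) b)
      (w : SolVertex (edgeIncidenceMatrix K33) b') (h : v.1 = w.1) :
      ∏ j, sgn v j * sgn w j = (-1) ^ (b v.1).val * (-1) ^ (b' v.1).val := by
    rw [Finset.prod_mul_distrib, prod_sgn, prod_sgn, h]
  refine quantumIsomorphic_of_projections (n := n) _ _ (fun v w => if v.1 = w.1 then P v w else 0)
    (fun v w => ?_) (fun v => ?_) (fun w => ?_) (fun v w h => ?_) (fun v w v' w' h => ?_)
  · split_ifs with h
    · exact (hX v.1).isStarProjection_signProj (hprod v w h) (hXsa v.1)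
    · exact .zero _
  · rw [sum_vertex fun k γ => if v.1 = k then
      signProj (equationOperator x v.1) fun j => sgn v j * γ j else 0]
    rw [Finset.sum_eq_single v.1 (fun k _ hk => by simp [hk.symm]) (by simp)]
    simp only [if_true, sum_signProj]
  · have h (v : SolVertex (edgeIncidenceMatrix K33) b) : (if v.1 = w.1 then P v w else 0) =
        if w.1 = v.1 then signProj (equationOperator x v.1) fun j => sgn w j * sgn v j else 0 := by
      simp only [P, mul_comm (sgn v _), eq_comm]
    simp only [h]
    rw [sum_vertex fun k γ => if w.1 = k then
      signProj (equationOperator x k) fun j => sgn w j * γ j else 0]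
    rw [Finset.sum_eq_single w.1 (fun k _ hk => by simp [hk.symm]) (by simp)]
    simp only [if_true, sum_signProj]
  · by_contra hne
    exact h (if_neg hne)
  · by_cases hvw : v.1 = w.1
    swap
    · simp [hvw] at h
    by_cases hvw' : v'.1 = w'.1
    swap
    · simp [hvw'] at h
    rw [if_pos hvw, if_pos hvw'] at h
    -- An operator shared by both equations has an eigenvalue on each projection; a nonzero product
    -- forces these to agree. Rearranged, `v, v'` have the same relative sign there as `w, w'`, and
    -- this determines adjacency and color.
    have key (j j') (e : equationOperator x v.1 j = equationOperator x v'.1 j') :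
        sgn v j * sgn w j = sgn v' j' * sgn w' j' := by
      by_contra hne
      refine h (mul_eq_zero_of_sign_ne ((hX v.1).signProj_mul (hprod v w hvw) j) ?_ hne)
      rw [e]
      exact (hX v'.1).mul_signProj (hprod v' w' hvw') j'
    by_cases hv : v.1 = v'.1
    · have hw : w.1 = w'.1 := hvw.symm.trans (hv.trans hvw')
      have hs (j) : sgn v j * sgn w j = sgn v' j * sgn w' j := key j j (by rw [hv])
      have heq : v = v' ↔ w = w' := by
        constructor
        · rintro rfl
          exact ext_sgn hw (funext fun j => mul_left_cancel (hs j))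
        · rintro rfl
          exact ext_sgn hv (funext fun j => mul_right_cancel (hs j))
      refine ⟨heq, fun d => ?_⟩
      rw [edgesOfColor_adj, edgesOfColor_adj,
        edgeColorFun_eq hv hw hvw fun j => mul_eq_mul_of_mul_eq_mul (hs j)]
      simp [hv, hw, heq]
    · have hw : w.1 ≠ w'.1 := fun e => hv (hvw.trans (e.trans hvw'.symm))
      refine ⟨iff_of_false (fun e => hv (congrArg _ e)) fun e => hw (congrArg _ e), fun d => ?_⟩
      rw [edgesOfColor_adj_of_ne hv, edgesOfColor_adj_of_ne hw]
      refine and_congr_left fun _ => ?_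
      rcases hk : v.1 with i | i <;> rcases hk' : v'.1 with j | j <;>
        rw [hk] at hvw <;> rw [hk'] at hvw'
      · have hij : i ≠ j := by rintro rfl; exact hv (hk.trans hk'.symm)
        exact iff_of_false (not_disagree_inl_inl hk hk' hij)
          (not_disagree_inl_inl hvw.symm hvw'.symm hij)
      · rw [disagree_of_inl_inr hk hk', disagree_of_inl_inr hvw.symm hvw'.symm,
          mul_eq_mul_of_mul_eq_mul (key j i (by rw [hk, hk']; rfl))]
      · rw [disagree_comm, disagree_of_inl_inr hk' hk, disagree_comm,
          disagree_of_inl_inr hvw'.symm hvw.symm,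
          mul_eq_mul_of_mul_eq_mul (key j i (by rw [hk, hk']; rfl)).symm]
      · have hij : i ≠ j := by rintro rfl; exact hv (hk.trans hk'.symm)
        exact iff_of_false (not_disagree_inr_inr hk hk' hij)
          (not_disagree_inr_inr hvw.symm hvw'.symm hij)

/-! ### The magic square -/

/-- The Mermin–Peres magic square: products of two Pauli matrices, with the product `1` in all rows
and columns except for the last column, where it is `-1`. -/
def magicSquare : Fin 3 → Fin 3 → Matrix (Fin 4) (Fin 4) ℤ :=
  ![![!![0, 0, 1, 0; 0, 0, 0, 1; 1, 0, 0, 0; 0, 1, 0, 0],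
      !![0, 1, 0, 0; 1, 0, 0, 0; 0, 0, 0, 1; 0, 0, 1, 0],
      !![0, 0, 0, 1; 0, 0, 1, 0; 0, 1, 0, 0; 1, 0, 0, 0]],
    ![!![1, 0, 0, 0; 0, -1, 0, 0; 0, 0, 1, 0; 0, 0, 0, -1],
      !![1, 0, 0, 0; 0, 1, 0, 0; 0, 0, -1, 0; 0, 0, 0, -1],
      !![1, 0, 0, 0; 0, -1, 0, 0; 0, 0, -1, 0; 0, 0, 0, 1]],
    ![!![0, 0, 1, 0; 0, 0, 0, -1; 1, 0, 0, 0; 0, -1, 0, 0],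
      !![0, 1, 0, 0; 1, 0, 0, 0; 0, 0, 0, -1; 0, 0, -1, 0],
      !![0, 0, 0, -1; 0, 0, 1, 0; 0, 1, 0, 0; -1, 0, 0, 0]]]

/-- With integer entries the identities of the square are decidable; they are later mapped to
complex matrices. -/
theorem magicSquare_transpose : ∀ i j, (magicSquare i j).transpose = magicSquare i j := by
  decide

theorem magicSquare_mul_self : ∀ i j, magicSquare i j * magicSquare i j = 1 := by
  decide

theorem magicSquare_row : ∀ i j l m, j ≠ l → l ≠ m → j ≠ m →
    magicSquare i j * magicSquare i l = magicSquare i m := by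
  decide

theorem magicSquare_col : ∀ j i k n, i ≠ k → k ≠ n → i ≠ n →
    magicSquare i j * magicSquare k j = (if j = 2 then -1 else 1 : ℤˣ) • magicSquare n j := by
  decide

/-- Signs with prescribed row and column products. -/
theorem exists_signs (r c : Fin 3 → ℤˣ) (h : (∏ i, r i) * ∏ j, c j = -1) :
    ∃ s : Fin 3 → Fin 3 → ℤˣ, (∀ i, ∏ j, s i j = r i) ∧
      ∀ j, ∏ i, s i j = c j * if j = 2 then -1 else 1 := by
  -- The first two rows use their last entry to meet the row condition; the last row is then forced
  -- by columns `0` and `1` and its own product. The last column is correct because the total sign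
  -- is `-1`.
  refine ⟨![![1, 1, r 0], ![1, 1, r 1], ![c 0, c 1, r 2 * c 0 * c 1]], ?_, ?_⟩
  · revert r c
    decide
  · revert r c
    decide

/-- The magic square multiplied entrywise by signs: the signs contribute total sign `1`, and its
exceptional last column supplies the remaining `-1`. -/
theorem exists_isOperatorSquare (r c : Fin 3 → ℤˣ) (h : (∏ i, r i) * ∏ j, c j = -1) :
    ∃ x : Fin 3 → Fin 3 → Matrix (Fin 4) (Fin 4) ℂ, IsOperatorSquare x r c ∧
      ∀ i j, IsSelfAdjoint (x i j) := by
  obtain ⟨s, hr, hc⟩ := exists_signs r c h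
  let φ : Matrix (Fin 4) (Fin 4) ℤ →+* Matrix (Fin 4) (Fin 4) ℂ := (Int.castRingHom ℂ).mapMatrix
  have hsmul (t : ℤˣ) (a) : φ (t • a) = t • φ a := map_zsmul φ _ _
  refine ⟨fun i j => φ (s i j • magicSquare i j), ⟨fun i => ⟨fun j => ?_, fun j l m h₁ h₂ h₃ => ?_⟩,
    fun j => ⟨fun i => ?_, fun i k n h₁ h₂ h₃ => ?_⟩⟩, fun i j => ?_⟩
  · rw [← map_mul, smul_mul_smul_comm, Int.units_mul_self, one_smul, magicSquare_mul_self, map_one]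
  · rw [← map_mul, smul_mul_smul_comm, magicSquare_row i j l m h₁ h₂ h₃,
      mul_of_prod_eq (s i) h₁ h₂ h₃, hr, mul_smul, hsmul]
  · rw [← map_mul, smul_mul_smul_comm, Int.units_mul_self, one_smul, magicSquare_mul_self, map_one]
  · rw [← map_mul, smul_mul_smul_comm, magicSquare_col j i k n h₁ h₂ h₃,
      mul_of_prod_eq (fun i => s i j) h₁ h₂ h₃, hc, smul_smul, mul_right_comm, mul_assoc (c j),
      Int.units_mul_self, mul_one, mul_smul, hsmul]
  · dsimp only
    rw [isSelfAdjoint_iff, hsmul, Units.smul_def, star_zsmul, Matrix.star_eq_conjTranspose]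
    congr 1
    ext p q
    have := congrFun (congrFun (magicSquare_transpose i j) p) q
    rw [Matrix.transpose_apply] at this
    simp [φ, this]

end K33

theorem corollary6p8 (M : Matrix (Fin 3 ⊕ Fin 3) K33.edgeSet (ZMod 2))
    (hM : M = edgeIncidenceMatrix K33) (b : Fin 3 ⊕ Fin 3 → ZMod 2) (hb : ∃! k, b k = 1) :
    ¬ (GStar M 0).Isomorphic (GStar M b) ∧
      ¬ (GStar M 0).HasQuantumSymmetry ∧
      ¬ (GStar M b).HasQuantumSymmetry ∧
      (GStar M 0).QuantumIsomorphic (GStar M b) := by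
  subst hM
  -- Only the vertex with `b k = 1` contributes. The total sign `-1` both excludes an isomorphism
  -- and permits the magic square.
  have hprod : ∏ k, (-1 : ℤˣ) ^ ((0 : Fin 3 ⊕ Fin 3 → ZMod 2) k).val * (-1) ^ (b k).val = -1 := by
    obtain ⟨k, hk, huniq⟩ := hb
    rw [Finset.prod_eq_single k]
    · rw [hk, Pi.zero_apply, ZMod.val_zero, pow_zero, one_mul]
      rfl
    · intro l _ hl
      have h01 : ∀ a : ZMod 2, a ≠ 1 → a = 0 := by decide
      rw [h01 (b l) fun h => hl (huniq l h)]
      simp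
    · simp
  obtain ⟨x, hx, hsa⟩ := K33.exists_isOperatorSquare _ _
    ((Fintype.prod_sum_type _).symm.trans hprod)
  exact ⟨K33.not_isomorphic hprod, K33.not_hasQuantumSymmetry 0, K33.not_hasQuantumSymmetry b,
    K33.quantumIsomorphic_of_isOperatorSquare hx hsa⟩
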